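/- Let $f:\mathbb R^n\to\mathbb R^n$, let $\Phi:\mathbb R^n\to\mathbb R^m$ be differentiable, and let $\theta:\mathbb R^m\to(-\infty,\infty]$ be an arbitrary proper function with basic (limiting) subdifferential $\partial\theta(z)=\{v:(v,-1)\in N((z,\theta(z));\mathrm{epi}\,\theta)\}$ for $\theta(z)<\infty$ and $\partial\theta(z)=\emptyset$ otherwise, where $N$ is the limiting (Mordukhovich) normal cone. Put $\Psi(x,v):=f(x)+\nabla\Phi(x)^*v$ and $$\Lambda(x):=\{v\in\mathbb R^m:\ \Psi(x,v)=0,\ v\in\partial\theta(\Phi(x))\},\qquad S(p_1,p_2):=\Big\{(x,v):\ \binom{p_1}{p_2}\in\binom{\Psi(x,v)}{-\Phi(x)}+\binom{0}{(\partial\theta)^{-1}(v)}\Big\}.$$ Let $\bar x\in\mathbb R^n$ be such that $f$ is differentiable at $\bar x$ and $\Phi$ is twice differentiable at $\bar x$, let $\bar v\in\Lambda(\bar x)$, and put $\bar z:=\Phi(\bar x)$. Denote by $(D\partial\theta)(\bar z,\bar v)$ the graphical derivative of $\partial\theta$ at $(\bar z,\bar v)$, i.e. $\eta\in(D\partial\theta)(\bar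 z,\bar v)(w)$ iff $(w,\eta)$ lies in the (Bouligand–Severi) tangent cone to $\mathrm{gph}\,\partial\theta$ at $(\bar z,\bar v)$. The multiplier $\bar v$ is called noncritical if $\xi=0$ is the only solution of $0\in\nabla_x\Psi(\bar x,\bar v)\xi+\nabla\Phi(\bar x)^*(D\partial\theta)(\bar z,\bar v)(\nabla\Phi(\bar x)\xi)$. The map $S$ is called isolatedly calm at $((0,0),(\bar x,\bar v))$ if there are $\ell\ge0$ and neighborhoods $U$ of $(0,0)$ and $V$ of $(\bar x,\bar v)$ such that $\|(x,v)-(\bar x,\bar v)\|\le\ell\|p\|$ whenever $p\in U$ and $(x,v)\in S(p)\cap V$. Then the following hold. (a) $\bar v$ is noncritical if and only if, for all $(\xi,\eta)\in\mathbb R^n\times\mathbb R^m$, $$\nabla_x\Psi(\bar x,\bar v)\xi+\nabla\Phi(\bar x)^*\eta=0,\quad \eta\in(D\partial\theta)(\bar z,\bar v)(\nabla\Phi(\bar x)\xi)\ \Longrightarrow\ \xi=0.$$ (b) $S$ is isolatedly calm at $((0,0),(\bar x,\bar v))$ if and only if, for all $(\xi,\eta)\in\mathbb R^n\times\mathbb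 R^m$, $$\nabla_x\Psi(\bar x,\bar v)\xi+\nabla\Phi(\bar x)^*\eta=0,\quad \eta\in(D\partial\theta)(\bar z,\bar v)(\nabla\Phi(\bar x)\xi)\ \Longrightarrow\ (\xi,\eta)=(0,0),$$ and in this case $S(0,0)\cap V=\{(\bar x,\bar v)\}$ for some neighborhood $V$ of $(\bar x,\bar v)$. (c) If moreover $\theta$ is convex piecewise linear ($\theta\in CPWL$), i.e. its epigraph is a convex polyhedron, and $\bar v$ is noncritical, then there is a neighborhood $V$ of $(\bar x,\bar v)$ with $S(0,0)\cap V=\big[\{\bar x\}\times\Lambda(\bar x)\big]\cap V$. -/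

import Mathlib

open Set Filter Topology
open scoped Pointwise InnerProductSpace

noncomputable section

namespace VarSys

/-! ### Normal cones, subdifferentials, polyhedral functions -/

section Normals

variable {H : Type*} [NormedAddCommGroup H] [InnerProductSpace ℝ H]

/-- The regular (Fréchet) normal cone to `Ω` at `z`. The condition
`limsup_{u → z, u ∈ Ω} ⟪v, u - z⟫ / ‖u - z‖ ≤ 0` is written in its `ε`-form; the point `u = z`
satisfies the inequality trivially. The cone is empty when `z ∉ Ω`. -/
def regularNormalCone (Ω : Set H) (z : H) : Set H :=
  {v | z ∈ Ω ∧ ∀ ε : ℝ, 0 < ε → ∀ᶠ u in 𝓝[Ω] z, ⟪v, u - z⟫_ℝ ≤ ε * ‖u - z‖}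

/-- The limiting (Mordukhovich) normal cone: limits of regular normals at points of `Ω`
converging to `z`. -/
def limitingNormalCone (Ω : Set H) (z : H) : Set H :=
  {v | ∃ (zs vs : ℕ → H), (∀ k, vs k ∈ regularNormalCone Ω (zs k)) ∧
    Tendsto zs atTop (𝓝 z) ∧ Tendsto vs atTop (𝓝 v)}

/-- A convex polyhedron: the intersection of finitely many closed half-spaces. -/
def IsConvexPolyhedron (C : Set H) : Prop :=
  ∃ (N : ℕ) (a : Fin N → H) (b : Fin N → ℝ), C = {x | ∀ i, ⟪a i, x⟫_ℝ ≤ b i}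

/-- Proper functions `θ : H → (-∞, ∞]`: never `-∞`, and finite somewhere. -/
def IsProper (θ : H → EReal) : Prop :=
  (∀ z, θ z ≠ ⊥) ∧ ∃ z, θ z ≠ ⊤

/-- The epigraph of `θ`, a subset of the Hilbert space `H × ℝ`. -/
def epi (θ : H → EReal) : Set (WithLp 2 (H × ℝ)) :=
  {w | θ w.fst ≤ (w.snd : EReal)}

/-- The basic (limiting) subdifferential: `v ∈ ∂θ(z)` iff `θ(z)` is a real number and `(v, -1)`
is a limiting normal to the epigraph of `θ` at `(z, θ(z))`. It is empty outside `dom θ`. -/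
def subdiff (θ : H → EReal) (z : H) : Set H :=
  {v | ∃ r : ℝ, θ z = (r : EReal) ∧
    WithLp.toLp 2 (v, (-1 : ℝ)) ∈ limitingNormalCone (epi θ) (WithLp.toLp 2 (z, r))}

/-- The class `CPWL` of convex piecewise linear functions: proper functions whose epigraph is a
convex polyhedron. -/
def IsCPWL (θ : H → EReal) : Prop :=
  IsProper θ ∧ IsConvexPolyhedron (epi θ)

end Normals

/-! ### Set-valued mappings -/

section SetValued

variable {X Y : Type*} [NormedAddCommGroup X] [NormedSpace ℝ X]
  [NormedAddCommGroup Y] [NormedSpace ℝ Y]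

/-- The graph of a set-valued mapping. -/
def gph (F : X → Set Y) : Set (X × Y) :=
  {q | q.2 ∈ F q.1}

/-- The graphical derivative `DF(x, y)`, whose graph is the Bouligand-Severi tangent cone
to the graph of `F` at `(x, y)`. Mathlib's `posTangentConeAt Ω z` consists of the limits of
`c k • d k` with `c k ≥ 0`, `d k → 0`, `z + d k ∈ Ω`. -/
def graphicalDeriv (F : X → Set Y) (x : X) (y : Y) (u : X) : Set Y :=
  {w | (u, w) ∈ posTangentConeAt (gph F) (x, y)}

/-- Isolated calmness of `F` at `(x₀, y₀) ∈ gph F`: for some `ℓ ≥ 0` and neighborhoods `U` of `x₀`,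
`V` of `y₀` one has `F(x) ∩ V ⊆ {y₀} + ℓ ‖x - x₀‖ 𝔹` for all `x ∈ U`. On product spaces the norm
is Mathlib's maximum norm; the property does not depend on the choice of equivalent norms. -/
def IsIsolatedlyCalmAt (F : X → Set Y) (x₀ : X) (y₀ : Y) : Prop :=
  y₀ ∈ F x₀ ∧ ∃ ℓ : ℝ, 0 ≤ ℓ ∧ ∃ U ∈ 𝓝 x₀, ∃ V ∈ 𝓝 y₀, ∀ x ∈ U,
    F x ∩ V ⊆ Metric.closedBall y₀ (ℓ * ‖x - x₀‖)

end SetValued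

/-! ### The variational system `Ψ(x, v) = 0`, `v ∈ ∂θ(Φ(x))` -/

section System

variable {E F : Type*} [NormedAddCommGroup E] [InnerProductSpace ℝ E] [CompleteSpace E]
  [NormedAddCommGroup F] [InnerProductSpace ℝ F] [CompleteSpace F]

/-- The adjoint `∇Φ(x)*` of the derivative of `Φ` at `x`. -/
def gradAdj (Φ : E → F) (x : E) : F →L[ℝ] E :=
  ContinuousLinearMap.adjoint (fderiv ℝ Φ x)

/-- `Ψ(x, v) = f(x) + ∇Φ(x)* v`. -/
def Psi (f : E → E) (Φ : E → F) (x : E) (v : F) : E :=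
  f x + gradAdj Φ x v

/-- The partial derivative `∇ₓΨ(x, v)`. -/
def gradPsi (f : E → E) (Φ : E → F) (x : E) (v : F) : E →L[ℝ] E :=
  fderiv ℝ (fun y => Psi f Φ y v) x

/-- The set `Λ(x)` of Lagrange multipliers associated with `x`. -/
def multipliers (f : E → E) (Φ : E → F) (θ : F → EReal) (x : E) : Set F :=
  {v | Psi f Φ x v = 0 ∧ v ∈ subdiff θ (Φ x)}

/-- Criticality of the multiplier `v ∈ Λ(x)`: the generalized equation
`0 ∈ ∇ₓΨ(x, v) ξ + ∇Φ(x)* (D∂θ)(Φ(x), v)(∇Φ(x) ξ)` has a solution `ξ ≠ 0`. -/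
def IsCritical (f : E → E) (Φ : E → F) (θ : F → EReal) (x : E) (v : F) : Prop :=
  ∃ ξ : E, ξ ≠ 0 ∧
    (0 : E) ∈ ({gradPsi f Φ x v ξ} : Set E) +
      gradAdj Φ x '' graphicalDeriv (subdiff θ) (Φ x) v (fderiv ℝ Φ x ξ)

/-- A multiplier is noncritical when it is not critical. -/
def IsNoncritical (f : E → E) (Φ : E → F) (θ : F → EReal) (x : E) (v : F) : Prop :=
  ¬ IsCritical f Φ θ x v

/-- The set-valued mapping `G(x, v) = (Ψ(x, v), -Φ(x)) + {0} × (∂θ)⁻¹(v)`. -/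
def mapG (f : E → E) (Φ : E → F) (θ : F → EReal) (q : E × F) : Set (E × F) :=
  {(Psi f Φ q.1 q.2, -Φ q.1)} + ({0} : Set E) ×ˢ {z : F | q.2 ∈ subdiff θ z}

/-- The solution map `S = G⁻¹` of the canonically perturbed system. -/
def solMap (f : E → E) (Φ : E → F) (θ : F → EReal) (p : E × F) : Set (E × F) :=
  {q | p ∈ mapG f Φ θ q}

end System

end VarSys

end

open VarSys

/-! Noncriticality is (a) after unfolding the set sum and the image. For (b) the system is
linearized at the reference point: $\Psi$ is jointly differentiable there, and $q\in S(p)$ means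
$\Psi(q)=p_1$ together with $v\in\partial\theta(\Phi(x)+p_2)$. If calmness fails,
`isIsolatedlyCalmAt_of_forall_eq_zero` divides the offending differences by their norm; a unit limit
$(\xi,\eta)$ solves the linearized system. Conversely, `eq_zero_of_isIsolatedlyCalmAt` turns a
solution $(\xi,\eta)$ into points of $S(p_k)$ with $p_k$ of smaller order than their displacement,
so calmness forces $(\xi,\eta)=0$.

In (c) one can only divide by $\|x-\bar x\|$, and $v-\bar v$ may be much larger. The equation
$\Psi=0$ still makes $\nabla\Phi(\bar x)^*(v-\bar v)/\|x-\bar x\|$ converge.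
`exists_mem_graphicalDeriv_of_tendsto` then finds an $\eta$ in the graphical derivative whose image
is this limit. There polyhedrality enters: finitely generated cones have closed linear images, so
the limit lifts even when the scaled multipliers are unbounded. Ultrafilters replace the extraction
of subsequences. -/

namespace VarSys

/-! ### Finitely generated cones -/

section FinCone

variable {ι V W : Type*} [AddCommGroup V] [Module ℝ V] [AddCommGroup W] [Module ℝ W]

/-- The convex cone generated by the vectors `a i`, `i ∈ s`. -/
def finCone (s : Finset ι) (a : ι → V) : Set V :=
  {x | ∃ c : ι → ℝ, (∀ i, 0 ≤ c i) ∧ ∑ i ∈ s, c i • a i = x}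

theorem finCone_add {s : Finset ι} {a : ι → V} {x y : V} (hx : x ∈ finCone s a)
    (hy : y ∈ finCone s a) : x + y ∈ finCone s a := by
  obtain ⟨c, hc, rfl⟩ := hx
  obtain ⟨d, hd, rfl⟩ := hy
  exact ⟨c + d, fun i => add_nonneg (hc i) (hd i), by simp [add_smul, Finset.sum_add_distrib]⟩

theorem finCone_smul {s : Finset ι} {a : ι → V} {x : V} {t : ℝ} (ht : 0 ≤ t)
    (hx : x ∈ finCone s a) : t • x ∈ finCone s a := by
  obtain ⟨c, hc, rfl⟩ := hx
  exact ⟨t • c, fun i => mul_nonneg ht (hc i), by simp [mul_smul, Finset.smul_sum]⟩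

theorem zero_mem_finCone (s : Finset ι) (a : ι → V) : (0 : V) ∈ finCone s a :=
  ⟨0, fun _ => le_rfl, by simp⟩

theorem finCone_mono {s t : Finset ι} (h : s ⊆ t) (a : ι → V) : finCone s a ⊆ finCone t a := by
  classical
  rintro _ ⟨c, hc, rfl⟩
  refine ⟨fun i => if i ∈ s then c i else 0, fun i => ?_, ?_⟩
  · dsimp only
    split_ifs
    exacts [hc i, le_rfl]
  · rw [← Finset.sum_subset h (fun i _ hi => by simp [hi])]
    exact Finset.sum_congr rfl fun i hi => by simp [hi]

theorem mem_finCone_of_mem {s : Finset ι} (a : ι → V) {i : ι} (hi : i ∈ s) :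
    a i ∈ finCone s a := by
  classical
  refine ⟨Pi.single i 1, fun j => ?_, ?_⟩
  · by_cases h : j = i
    · subst h; simp
    · simp [h]
  · rw [Finset.sum_eq_single i]
    · simp
    · intro j _ hj; simp [hj]
    · exact fun h => absurd hi h

theorem image_finCone (L : V →ₗ[ℝ] W) (s : Finset ι) (a : ι → V) :
    L '' finCone s a = finCone s (L ∘ a) := by
  ext y
  constructor
  · rintro ⟨_, ⟨c, hc, rfl⟩, rfl⟩
    exact ⟨c, hc, by simp⟩
  · rintro ⟨c, hc, rfl⟩
    exact ⟨_, ⟨c, hc, rfl⟩, by simp⟩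

/-- **Conic Carathéodory reduction**: a generator can be dropped when the generators are
linearly dependent. -/
theorem exists_mem_finCone_erase [DecidableEq ι] {s : Finset ι} {a : ι → V}
    (h : ¬ LinearIndepOn ℝ a (s : Set ι)) {x : V} (hx : x ∈ finCone s a) :
    ∃ i ∈ s, x ∈ finCone (s.erase i) a := by
  obtain ⟨c, hc, rfl⟩ := hx
  obtain ⟨g, hg, hpos⟩ : ∃ g : ι → ℝ, ∑ i ∈ s, g i • a i = 0 ∧ ∃ i ∈ s, 0 < g i := by
    rw [linearIndepOn_finset_iff] at h
    push Not at h
    obtain ⟨g, hg, i, hi, hgi⟩ := h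
    rcases lt_or_gt_of_ne hgi with hlt | hgt
    · exact ⟨-g, by simp [hg], i, hi, by simpa using hlt⟩
    · exact ⟨g, hg, i, hi, hgt⟩
  obtain ⟨i₀, hi₀, hgi₀⟩ := hpos
  -- The minimal ratio is the largest `t` for which all coefficients `c j - t * g j` on `s` stay
  -- nonnegative; the coefficient of the minimizer vanishes.
  obtain ⟨i, hi, hmin⟩ := (s.filter fun i => 0 < g i).exists_min_image (fun i => c i / g i)
    ⟨i₀, by simp [hi₀, hgi₀]⟩
  obtain ⟨his, hgi⟩ := Finset.mem_filter.1 hi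
  set t := c i / g i with ht
  have ht0 : 0 ≤ t := div_nonneg (hc i) hgi.le
  have hnn : ∀ j ∈ s, 0 ≤ c j - t * g j := by
    intro j hj
    rcases le_or_gt (g j) 0 with hle | hlt
    · nlinarith [hc j, mul_nonpos_of_nonneg_of_nonpos ht0 hle]
    · have := hmin j (by simp [hj, hlt])
      rw [le_div_iff₀ hlt] at this
      linarith
  -- `finCone` asks for nonnegative coefficients at every index, also outside `s`; truncation at
  -- zero achieves this and changes nothing on `s`.
  refine ⟨i, his, fun j => max (c j - t * g j) 0, fun j => le_max_right _ _, ?_⟩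
  have h1 : ∑ j ∈ s, (c j - t * g j) • a j = ∑ j ∈ s, c j • a j := by
    simp only [sub_smul, mul_smul, Finset.sum_sub_distrib, ← Finset.smul_sum, hg]
    simp
  rw [← h1, ← Finset.add_sum_erase s _ his]
  have h2 : c i - t * g i = 0 := by rw [ht]; field_simp; ring
  rw [h2, zero_smul, zero_add]
  refine Finset.sum_congr rfl fun j hj => ?_
  dsimp only
  rw [max_eq_left (hnn j (Finset.mem_of_mem_erase hj))]

/-- Independent generators make the cone the image of a closed orthant under an injective linear map
from a finite-dimensional space, hence closed. Dependent generators make it a finite union of cones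
with one generator fewer, to which induction applies. -/
theorem isClosed_finCone [TopologicalSpace V] [IsTopologicalAddGroup V] [ContinuousSMul ℝ V]
    [T2Space V] (s : Finset ι) (a : ι → V) : IsClosed (finCone s a) := by
  classical
  induction s using Finset.strongInduction with
  | H s ih =>
    by_cases h : LinearIndepOn ℝ a (s : Set ι)
    · have hinj : LinearMap.ker (Fintype.linearCombination ℝ (fun i : s => a i)) = ⊥ := by
        rw [LinearMap.ker_eq_bot, ← linearIndependent_iff_injective_fintypeLinearCombination]
        exact h
      have himg : finCone s a =
          Fintype.linearCombination ℝ (fun i : s => a i) '' {c | ∀ i, 0 ≤ c i} := by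
        ext x
        constructor
        · rintro ⟨c, hc, rfl⟩
          refine ⟨fun i => c i, fun i => hc i, ?_⟩
          rw [Fintype.linearCombination_apply]
          exact Finset.sum_coe_sort s fun i => c i • a i
        · rintro ⟨c, hc, rfl⟩
          refine ⟨fun i => if hi : i ∈ s then c ⟨i, hi⟩ else 0, fun i => ?_, ?_⟩
          · dsimp only
            split_ifs
            exacts [hc _, le_rfl]
          · rw [Fintype.linearCombination_apply, ← Finset.sum_coe_sort s]
            exact Finset.sum_congr rfl fun i _ => by simp
      rw [himg]
      refine (LinearMap.isClosedEmbedding_of_injective hinj).isClosedMap _ ?_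
      simp only [ofPred_forall]
      exact isClosed_iInter fun i => isClosed_le continuous_const (continuous_apply i)
    · have hU : finCone s a = ⋃ i ∈ s, finCone (s.erase i) a := by
        ext x
        simp only [mem_iUnion, exists_prop]
        exact ⟨exists_mem_finCone_erase h,
          fun ⟨i, _, hx⟩ => finCone_mono (Finset.erase_subset i s) a hx⟩
      rw [hU]
      exact s.finite_toSet.isClosed_biUnion fun i hi => ih _ (Finset.erase_ssubset hi)

end FinCone

/-! ### Normals to convex polyhedra -/

section Polyhedron

variable {ι H : Type*} [NormedAddCommGroup H] [InnerProductSpace ℝ H]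

/-- **Farkas' lemma** for finitely many homogeneous linear inequalities. -/
theorem mem_finCone_of_forall_inner_nonpos [CompleteSpace H] {s : Finset ι} {a : ι → H} {y : H}
    (h : ∀ u, (∀ i ∈ s, ⟪a i, u⟫_ℝ ≤ 0) → ⟪y, u⟫_ℝ ≤ 0) : y ∈ finCone s a := by
  by_contra hy
  let C : ProperCone ℝ H :=
    { carrier := finCone s a
      add_mem' := finCone_add
      zero_mem' := zero_mem_finCone s a
      smul_mem' := fun c _ hx => finCone_smul c.2 hx
      isClosed' := isClosed_finCone s a }
  obtain ⟨u, hu, hyu⟩ := C.hyperplane_separation' (x₀ := y) hy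
  have := h (-u) fun i hi => by
    have := hu (a i) (mem_finCone_of_mem a hi)
    simpa using this
  simp only [inner_neg_right] at this
  linarith

theorem convex_polyhedron (a : ι → H) (b : ι → ℝ) : Convex ℝ {x | ∀ i, ⟪a i, x⟫_ℝ ≤ b i} := by
  rw [ofPred_forall]
  exact convex_iInter fun i => convex_halfSpace_le (innerₗ H (a i)).isLinear (b i)

variable [Fintype ι]

open Classical in
/-- The indices of the constraints `⟪a i, ·⟫ ≤ b i` that are active at `p`. -/
noncomputable def activeSet (a : ι → H) (b : ι → ℝ) (p : H) : Finset ι :=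
  Finset.univ.filter fun i => ⟪a i, p⟫_ℝ = b i

theorem mem_activeSet {a : ι → H} {b : ι → ℝ} {p : H} {i : ι} :
    i ∈ activeSet a b p ↔ ⟪a i, p⟫_ℝ = b i := by
  simp [activeSet]

theorem eventually_add_smul_mem_polyhedron {a : ι → H} {b : ι → ℝ} {p u : H}
    (hp : ∀ i, ⟪a i, p⟫_ℝ ≤ b i) (hu : ∀ i ∈ activeSet a b p, ⟪a i, u⟫_ℝ ≤ 0) :
    ∀ᶠ t : ℝ in 𝓝[>] 0, ∀ i, ⟪a i, p + t • u⟫_ℝ ≤ b i := by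
  rw [eventually_all]
  intro i
  by_cases hi : i ∈ activeSet a b p
  · filter_upwards [self_mem_nhdsWithin] with t ht
    rw [inner_add_right, inner_smul_right]
    nlinarith [hp i, mul_nonpos_of_nonneg_of_nonpos (le_of_lt (mem_Ioi.1 ht)) (hu i hi)]
  · have hlt : ⟪a i, p⟫_ℝ < b i := lt_of_le_of_ne (hp i) fun h => hi (mem_activeSet.2 h)
    have hc : Tendsto (fun t : ℝ => ⟪a i, p + t • u⟫_ℝ) (𝓝 0) (𝓝 ⟪a i, p⟫_ℝ) := by
      have : Continuous fun t : ℝ => ⟪a i, p + t • u⟫_ℝ := by fun_prop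
      simpa using this.tendsto 0
    exact ((hc.eventually_lt_const hlt).filter_mono nhdsWithin_le_nhds).mono fun t ht => ht.le

/-- A direction that satisfies the active constraints stays feasible for a short time, so a normal
is nonpositive on it; Farkas' lemma then expresses the normal through the active gradients. -/
theorem forall_inner_sub_nonpos_iff_mem_finCone [CompleteSpace H] {a : ι → H} {b : ι → ℝ} {p y : H}
    (hp : ∀ i, ⟪a i, p⟫_ℝ ≤ b i) :
    (∀ u, (∀ i, ⟪a i, u⟫_ℝ ≤ b i) → ⟪y, u - p⟫_ℝ ≤ 0) ↔ y ∈ finCone (activeSet a b p) a := by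
  constructor
  · intro h
    refine mem_finCone_of_forall_inner_nonpos fun u hu => ?_
    obtain ⟨t, ht, ht0⟩ :=
      ((eventually_add_smul_mem_polyhedron hp hu).and self_mem_nhdsWithin).exists
    have := h _ ht
    rw [add_sub_cancel_left, inner_smul_right] at this
    exact nonpos_of_mul_nonpos_right this ht0
  · rintro ⟨c, hc, rfl⟩ u hu
    rw [sum_inner]
    refine Finset.sum_nonpos fun i hi => ?_
    rw [inner_smul_left, inner_sub_right, mem_activeSet.1 hi]
    exact mul_nonpos_of_nonneg_of_nonpos (hc i) (sub_nonpos.2 (hu i))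

/-- Moving from a point of `Ω` a fraction `t` towards `u` and dividing by `t` makes the local
estimate global; the resulting inequality is stable under limits. -/
theorem limitingNormalCone_of_convex {Ω : Set H} (hΩ : Convex ℝ Ω) {z : H} (hz : z ∈ Ω) :
    limitingNormalCone Ω z = {y | ∀ u ∈ Ω, ⟪y, u - z⟫_ℝ ≤ 0} := by
  ext y
  constructor
  · rintro ⟨zs, vs, hreg, hzs, hvs⟩ u hu
    have hk : ∀ k, ⟪vs k, u - zs k⟫_ℝ ≤ 0 := by
      intro k
      obtain ⟨hzk, hε⟩ := hreg k
      have hle : ∀ ε : ℝ, 0 < ε → ⟪vs k, u - zs k⟫_ℝ ≤ ε * ‖u - zs k‖ := by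
        intro ε hpos
        have hT : Tendsto (fun t : ℝ => zs k + t • (u - zs k)) (𝓝[>] 0) (𝓝[Ω] zs k) := by
          refine tendsto_nhdsWithin_iff.2 ⟨?_, ?_⟩
          · have : Continuous fun t : ℝ => zs k + t • (u - zs k) := by fun_prop
            simpa using (this.tendsto 0).mono_left nhdsWithin_le_nhds
          · filter_upwards [Ioc_mem_nhdsGT (zero_lt_one' ℝ)] with t ht
            exact hΩ.add_smul_sub_mem hzk hu ⟨ht.1.le, ht.2⟩
        obtain ⟨t, ht, ht0⟩ := ((hT.eventually (hε ε hpos)).and self_mem_nhdsWithin).exists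
        have ht0 : 0 < t := ht0
        rw [add_sub_cancel_left, inner_smul_right, norm_smul, Real.norm_of_nonneg ht0.le] at ht
        refine le_of_mul_le_mul_left (a := t) ?_ ht0
        linarith
      have hlim : Tendsto (fun ε : ℝ => ε * ‖u - zs k‖) (𝓝[>] 0) (𝓝 0) := by
        have : Continuous fun ε : ℝ => ε * ‖u - zs k‖ := by fun_prop
        simpa using (this.tendsto 0).mono_left nhdsWithin_le_nhds
      exact ge_of_tendsto hlim (by filter_upwards [self_mem_nhdsWithin] with ε h using hle ε h)
    exact le_of_tendsto' (hvs.inner (tendsto_const_nhds.sub hzs)) hk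
  · intro hy
    refine ⟨fun _ => z, fun _ => y, fun _ => ⟨hz, fun ε hε => ?_⟩, tendsto_const_nhds,
      tendsto_const_nhds⟩
    filter_upwards [self_mem_nhdsWithin] with u hu
    exact (hy u hu).trans (by positivity)

end Polyhedron

/-! ### Subgradients of convex piecewise linear functions -/

section CPWL

variable {F G : Type*} [NormedAddCommGroup F] [InnerProductSpace ℝ F]
  [AddCommGroup G] [Module ℝ G] [TopologicalSpace G] [IsTopologicalAddGroup G]
  [ContinuousSMul ℝ G] [T2Space G]

theorem inner_toLp_neg_one (v : F) (u : WithLp 2 (F × ℝ)) :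
    ⟪WithLp.toLp 2 (v, (-1 : ℝ)), u⟫_ℝ = ⟪v, u.fst⟫_ℝ - u.snd := by
  rw [WithLp.prod_inner_apply]
  simp [sub_eq_add_neg]

variable {N : ℕ} {a : Fin N → WithLp 2 (F × ℝ)} {b : Fin N → ℝ} {θ : F → EReal}

theorem mem_subdiff_iff (hepi : epi θ = {x | ∀ i, ⟪a i, x⟫_ℝ ≤ b i}) {z v : F} :
    v ∈ subdiff θ z ↔ ∃ r : ℝ, θ z = r ∧ ∀ (z' : F) (r' : ℝ), θ z' ≤ r' →
      ⟪v, z' - z⟫_ℝ ≤ r' - r := by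
  have hconv : Convex ℝ (epi θ) := hepi ▸ convex_polyhedron a b
  refine exists_congr fun r => and_congr_right fun hr => ?_
  rw [limitingNormalCone_of_convex hconv (show θ z ≤ (r : EReal) from hr.le)]
  constructor
  · intro h z' r' hz'
    have := h (WithLp.toLp 2 (z', r')) hz'
    rw [inner_toLp_neg_one] at this
    simpa using this
  · intro h u hu
    rw [inner_toLp_neg_one]
    simpa using h u.fst u.snd hu

variable [FiniteDimensional ℝ F]

/-- The right side does not require `r` to be the value of `θ`: the component `-1` of the normal
forces it. This allows membership to be checked along a ray without computing `θ`. -/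
theorem mem_subdiff_iff_finCone (hθ : ∀ z, θ z ≠ ⊥)
    (hepi : epi θ = {x | ∀ i, ⟪a i, x⟫_ℝ ≤ b i}) {z v : F} :
    v ∈ subdiff θ z ↔ ∃ r : ℝ, (∀ i, ⟪a i, WithLp.toLp 2 (z, r)⟫_ℝ ≤ b i) ∧
      WithLp.toLp 2 (v, (-1 : ℝ)) ∈ finCone (activeSet a b (WithLp.toLp 2 (z, r))) a := by
  have hmem : ∀ u, (∀ i, ⟪a i, u⟫_ℝ ≤ b i) ↔ u ∈ epi θ := fun u => by rw [hepi]; rfl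
  rw [mem_subdiff_iff hepi]
  refine exists_congr fun r => ?_
  constructor
  · rintro ⟨hr, h⟩
    have hz := (hmem (WithLp.toLp 2 (z, r))).2 hr.le
    refine ⟨hz, (forall_inner_sub_nonpos_iff_mem_finCone hz).1 fun u hu => ?_⟩
    rw [inner_toLp_neg_one]
    simpa using h u.fst u.snd ((hmem u).1 hu)
  · rintro ⟨hz, h⟩
    have h := (forall_inner_sub_nonpos_iff_mem_finCone hz).2 h
    have h' : ∀ (z' : F) (r' : ℝ), θ z' ≤ r' → ⟪v, z' - z⟫_ℝ ≤ r' - r := by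
      intro z' r' hz'
      have := h (WithLp.toLp 2 (z', r')) ((hmem _).2 hz')
      rw [inner_toLp_neg_one] at this
      simpa using this
    have hle : θ z ≤ (r : EReal) := (hmem (WithLp.toLp 2 (z, r))).1 hz
    have htop : θ z ≠ ⊤ := fun h => by simp [h] at hle
    lift θ z to ℝ using ⟨htop, hθ z⟩ with s hs
    have := h' z s hs.ge
    rw [sub_self, inner_zero_right] at this
    have hle' : s ≤ r := EReal.coe_le_coe_iff.1 hle
    exact ⟨by rw [le_antisymm hle' (by linarith)], h'⟩

/-- Subgradients near a reference point give rise to tangent directions of the graph of the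
subdifferential of a convex piecewise linear function, even when they approach the reference
subgradient slowly, as long as their images under a linear map converge at the proper rate. -/
theorem exists_mem_graphicalDeriv_of_tendsto (hθ : IsCPWL θ) {zbar vbar : F}
    (hv : vbar ∈ subdiff θ zbar) {α : Type*} (l : Ultrafilter α) {z v : α → F} {c : α → ℝ}
    {w : F} {g : G} (T : F →ₗ[ℝ] G) (hmem : ∀ᶠ k in l, v k ∈ subdiff θ (z k))
    (hc : ∀ᶠ k in l, 0 ≤ c k) (hzlim : Tendsto z l (𝓝 zbar)) (hvlim : Tendsto v l (𝓝 vbar))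
    (hw : Tendsto (fun k => c k • (z k - zbar)) l (𝓝 w))
    (hg : Tendsto (fun k => c k • T (v k - vbar)) l (𝓝 g)) :
    ∃ η, T η = g ∧ η ∈ graphicalDeriv (subdiff θ) zbar vbar w := by
  obtain ⟨⟨hbot, -⟩, N, a, b, hepi⟩ := hθ
  have hmemepi : ∀ u, (∀ i, ⟪a i, u⟫_ℝ ≤ b i) ↔ u ∈ epi θ := fun u => by rw [hepi]; rfl
  have hvar := (mem_subdiff_iff hepi).1 hv
  obtain ⟨rbar, hrbar, hvbar⟩ := hvar
  have hex : ∀ k, ∃ r : ℝ, v k ∈ subdiff θ (z k) → θ (z k) = r ∧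
      (∀ (z' : F) (r' : ℝ), θ z' ≤ r' → ⟪v k, z' - z k⟫_ℝ ≤ r' - r) ∧
      WithLp.toLp 2 (v k, (-1 : ℝ)) ∈ finCone (activeSet a b (WithLp.toLp 2 (z k, r))) a := by
    intro k
    by_cases hk : v k ∈ subdiff θ (z k)
    · obtain ⟨r, hr, h⟩ := (mem_subdiff_iff hepi).1 hk
      refine ⟨r, fun _ => ⟨hr, h, ?_⟩⟩
      refine (forall_inner_sub_nonpos_iff_mem_finCone ((hmemepi _).2 hr.le)).1 fun u hu => ?_
      rw [inner_toLp_neg_one]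
      simpa using h u.fst u.snd ((hmemepi u).1 hu)
    · exact ⟨0, fun h => absurd h hk⟩
  choose r hr using hex
  have hmem' := hmem.mono hr
  -- The subgradient inequalities at `zbar` and at `z k` enclose the increment of `θ`, so it has the
  -- rate of `z k - zbar` although no bound on the rate of `v k` is available.
  have hlow : ∀ᶠ k in l, ⟪vbar, z k - zbar⟫_ℝ ≤ r k - rbar := by
    filter_upwards [hmem'] with k hk using hvbar _ _ hk.1.le
  have hup : ∀ᶠ k in l, r k - rbar ≤ ⟪v k, z k - zbar⟫_ℝ := by
    filter_upwards [hmem'] with k hk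
    have := hk.2.1 zbar rbar hrbar.le
    rw [← neg_sub, inner_neg_right] at this
    linarith
  have hz0 : Tendsto (fun k => z k - zbar) l (𝓝 0) := by
    simpa using hzlim.sub_const zbar
  have hrlim : Tendsto r l (𝓝 rbar) := by
    have h1 : Tendsto (fun k => ⟪vbar, z k - zbar⟫_ℝ) l (𝓝 0) := by
      simpa using (tendsto_const_nhds (x := vbar)).inner hz0
    have h2 : Tendsto (fun k => ⟪v k, z k - zbar⟫_ℝ) l (𝓝 0) := by
      simpa using hvlim.inner hz0
    have := tendsto_of_tendsto_of_tendsto_of_le_of_le' h1 h2 hlow hup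
    simpa using this.add_const rbar
  have hρ : Tendsto (fun k => c k * (r k - rbar)) l (𝓝 ⟪vbar, w⟫_ℝ) := by
    refine tendsto_of_tendsto_of_tendsto_of_le_of_le'
      ((tendsto_const_nhds (x := vbar)).inner hw) (hvlim.inner hw) ?_ ?_
    · filter_upwards [hlow, hc] with k hk hck
      rw [inner_smul_right]
      exact mul_le_mul_of_nonneg_left hk hck
    · filter_upwards [hup, hc] with k hk hck
      rw [inner_smul_right]
      exact mul_le_mul_of_nonneg_left hk hck
  have hLp : Continuous (fun q : F × ℝ => WithLp.toLp 2 q) := WithLp.prod_continuous_toLp 2 F ℝ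
  set p : α → WithLp 2 (F × ℝ) := fun k => WithLp.toLp 2 (z k, r k) with hp
  set pbar : WithLp 2 (F × ℝ) := WithLp.toLp 2 (zbar, rbar) with hpbar
  set ω : WithLp 2 (F × ℝ) := WithLp.toLp 2 (w, ⟪vbar, w⟫_ℝ) with hω
  set ybar : WithLp 2 (F × ℝ) := WithLp.toLp 2 (vbar, (-1 : ℝ)) with hybar
  have hplim : Tendsto p l (𝓝 pbar) := (hLp.tendsto _).comp (hzlim.prodMk_nhds hrlim)
  have hωlim : Tendsto (fun k => c k • (p k - pbar)) l (𝓝 ω) :=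
    (hLp.tendsto _).comp (hw.prodMk_nhds hρ)
  have hpk : ∀ᶠ k in l, ∀ i, ⟪a i, p k⟫_ℝ ≤ b i := by
    filter_upwards [hmem'] with k hk using (hmemepi _).2 hk.1.le
  have hpbarP : ∀ i, ⟪a i, pbar⟫_ℝ ≤ b i := (hmemepi _).2 hrbar.le
  -- There are finitely many possible active sets, so the ultrafilter selects one of them.
  obtain ⟨I, hI⟩ : ∃ I : Finset (Fin N), ∀ᶠ k in l, activeSet a b (p k) = I := by
    classical
    refine ⟨Finset.univ.filter fun i => ∀ᶠ k in l, i ∈ activeSet a b (p k), ?_⟩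
    have : ∀ᶠ k in l, ∀ i, (i ∈ activeSet a b (p k) ↔ ∀ᶠ k in l, i ∈ activeSet a b (p k)) := by
      rw [eventually_all]
      intro i
      rcases l.em fun k => i ∈ activeSet a b (p k) with h | h
      · filter_upwards [h] with k hk using iff_of_true hk h
      · filter_upwards [h] with k hk using iff_of_false hk (Ultrafilter.eventually_not.1 h)
    filter_upwards [this] with k hk
    ext i
    simp [hk i]
  have hyk : ∀ᶠ k in l, WithLp.toLp 2 (v k, (-1 : ℝ)) ∈ finCone I a := by
    filter_upwards [hmem', hI] with k hk hIk
    exact hIk ▸ hk.2.2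
  have hybarI : ybar ∈ finCone I a :=
    (isClosed_finCone I a).mem_of_tendsto
      ((hLp.tendsto _).comp (hvlim.prodMk_nhds (tendsto_const_nhds (x := (-1 : ℝ))))) hyk
  have hIpbar : ∀ i ∈ I, ⟪a i, pbar⟫_ℝ = b i := by
    intro i hi
    refine tendsto_nhds_unique (((tendsto_const_nhds (x := a i)).inner hplim)) ?_
    refine tendsto_const_nhds.congr' ?_
    filter_upwards [hI] with k hk
    exact (mem_activeSet.1 (hk ▸ hi)).symm
  have hIω : ∀ i ∈ I, ⟪a i, ω⟫_ℝ = 0 := by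
    intro i hi
    refine tendsto_nhds_unique (((tendsto_const_nhds (x := a i)).inner hωlim)) ?_
    refine tendsto_const_nhds.congr' ?_
    filter_upwards [hI] with k hk
    rw [inner_smul_right, inner_sub_right, mem_activeSet.1 (hk ▸ hi), hIpbar i hi]
    simp
  have hωnp : ∀ i ∈ activeSet a b pbar, ⟪a i, ω⟫_ℝ ≤ 0 := by
    intro i hi
    refine le_of_tendsto ((tendsto_const_nhds (x := a i)).inner hωlim) ?_
    filter_upwards [hpk, hc] with k hk hck
    rw [inner_smul_right, inner_sub_right, mem_activeSet.1 hi]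
    exact mul_nonpos_of_nonneg_of_nonpos hck (sub_nonpos.2 (hk i))
  -- Adjoining the generator `-ybar` puts all differences from `ybar` in one finitely generated
  -- cone. Its image under `L` is closed, so the limit has a preimage `y` although the differences
  -- themselves need not converge.
  let a' : Option (Fin N) → WithLp 2 (F × ℝ) := fun o => o.elim (-ybar) a
  let L : WithLp 2 (F × ℝ) →ₗ[ℝ] G × ℝ :=
    (T.prodMap LinearMap.id).comp (WithLp.linearEquiv 2 ℝ (F × ℝ)).toLinearMap
  have hgmem : (g, (0 : ℝ)) ∈ L '' finCone I.insertNone a' := by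
    rw [image_finCone]
    refine (isClosed_finCone I.insertNone (L ∘ a')).mem_of_tendsto
      (hg.prodMk_nhds (tendsto_const_nhds (x := (0 : ℝ)))) ?_
    filter_upwards [hyk, hc] with k ⟨d, hd, hsum⟩ hck
    rw [← image_finCone]
    refine ⟨c k • (WithLp.toLp 2 (v k, (-1 : ℝ)) - ybar), finCone_smul hck ?_, ?_⟩
    · refine ⟨fun o => o.elim 1 d, fun o => ?_, ?_⟩
      · cases o
        exacts [zero_le_one, hd _]
      · rw [Finset.sum_insertNone]
        simp only [Option.elim, a', hsum]
        module
    · simp [L, hybar]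
  obtain ⟨y, ⟨d, hd, hsum⟩, hLy⟩ := hgmem
  rw [Finset.sum_insertNone] at hsum
  simp only [Option.elim, a'] at hsum
  have hTy : T y.fst = g := congrArg Prod.fst hLy
  have hy0 : y.snd = 0 := congrArg Prod.snd hLy
  -- A whole segment of the ray from `(zbar, vbar)` in the direction `(w, y.fst)` lies in the graph.
  refine ⟨y.fst, hTy, mem_posTangentConeAt_of_frequently_mem (Eventually.frequently ?_)⟩
  have hsmall : ∀ᶠ t : ℝ in 𝓝[>] 0, t * d none ≤ 1 := by
    have hcont : Tendsto (fun t : ℝ => t * d none) (𝓝 0) (𝓝 0) := by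
      simpa using (continuous_mul_const (d none)).tendsto (0 : ℝ)
    exact ((hcont.eventually_lt_const zero_lt_one).filter_mono nhdsWithin_le_nhds).mono
      fun t ht => ht.le
  filter_upwards [eventually_add_smul_mem_polyhedron hpbarP hωnp, hsmall, self_mem_nhdsWithin]
    with t ht hts ht0
  have ht0 : 0 < t := ht0
  refine (mem_subdiff_iff_finCone hbot hepi).2 ⟨rbar + t * ⟪vbar, w⟫_ℝ, ht, ?_⟩
  refine finCone_mono (s := I) (fun i hi => mem_activeSet.2 ?_) a ?_
  · change ⟪a i, pbar + t • ω⟫_ℝ = b i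
    rw [inner_add_right, inner_smul_right, hIω i hi, hIpbar i hi, mul_zero, add_zero]
  -- The negative multiple of `ybar` in `y` is absorbed by `ybar` as long as `t * d none ≤ 1`.
  · have hdecomp : WithLp.toLp 2 (vbar + t • y.fst, (-1 : ℝ)) =
        (1 - t * d none) • ybar + t • ∑ i ∈ I, d (some i) • a i := by
      have h1 : WithLp.toLp 2 (vbar + t • y.fst, (-1 : ℝ)) = ybar + t • y := by
        refine (WithLp.equiv 2 _).injective (Prod.ext rfl ?_)
        change (-1 : ℝ) = -1 + t * y.snd
        rw [hy0]; ring
      rw [h1, ← hsum]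
      module
    change WithLp.toLp 2 (vbar + t • y.fst, (-1 : ℝ)) ∈ _
    rw [hdecomp]
    exact finCone_add (finCone_smul (by linarith) hybarI)
      (finCone_smul ht0.le ⟨fun i => d (some i), fun i => hd _, rfl⟩)

end CPWL

/-! ### Differentiability of the system -/

section System

variable {E F : Type*} [NormedAddCommGroup E] [InnerProductSpace ℝ E] [CompleteSpace E]
  [NormedAddCommGroup F] [InnerProductSpace ℝ F] [CompleteSpace F]
  {f : E → E} {Φ : E → F} {θ : F → EReal} {xbar : E} {vbar : F}

theorem differentiableAt_gradAdj (hΦ₂ : DifferentiableAt ℝ (fderiv ℝ Φ) xbar) :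
    DifferentiableAt ℝ (gradAdj Φ) xbar := by
  -- The adjoint is conjugate-linear in general; over `ℝ` it is repackaged as a bounded linear map.
  let A : (E →L[ℝ] F) →L[ℝ] (F →L[ℝ] E) :=
    LinearMap.mkContinuous
      { toFun := fun T => ContinuousLinearMap.adjoint T
        map_add' := fun S T => map_add _ S T
        map_smul' := fun c T => by simp } 1
      fun T => by simp
  exact A.differentiableAt.comp xbar hΦ₂

theorem hasFDerivAt_Psi (hf : DifferentiableAt ℝ f xbar)
    (hΦ₂ : DifferentiableAt ℝ (fderiv ℝ Φ) xbar) :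
    HasFDerivAt (fun q : E × F => Psi f Φ q.1 q.2)
      ((gradPsi f Φ xbar vbar).coprod (gradAdj Φ xbar)) (xbar, vbar) := by
  have hd : DifferentiableAt ℝ (fun q : E × F => Psi f Φ q.1 q.2) (xbar, vbar) := by
    have h1 : DifferentiableAt ℝ (fun q : E × F => f q.1) (xbar, vbar) :=
      DifferentiableAt.comp (xbar, vbar) (f := Prod.fst) hf differentiableAt_fst
    have h2 : DifferentiableAt ℝ (fun q : E × F => gradAdj Φ q.1) (xbar, vbar) :=
      DifferentiableAt.comp (xbar, vbar) (f := Prod.fst) (differentiableAt_gradAdj hΦ₂)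
        differentiableAt_fst
    exact h1.add (h2.clm_apply differentiableAt_snd)
  -- The derivative is identified by its restrictions to the two coordinate subspaces.
  obtain ⟨L, hL⟩ := hd
  convert hL
  have h1 : HasFDerivAt (fun x => Psi f Φ x vbar) (L.comp (.inl ℝ E F)) xbar :=
    HasFDerivAt.comp xbar (f := fun x : E => (x, vbar)) hL (hasFDerivAt_prodMk_left xbar vbar)
  have h2 : HasFDerivAt (fun v => Psi f Φ xbar v) (L.comp (.inr ℝ E F)) vbar :=
    HasFDerivAt.comp vbar (f := fun v : F => (xbar, v)) hL (hasFDerivAt_prodMk_right xbar vbar)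
  have h2' : HasFDerivAt (fun v => Psi f Φ xbar v) (gradAdj Φ xbar) vbar :=
    (gradAdj Φ xbar).hasFDerivAt.const_add (f xbar)
  rw [h2'.unique h2, gradPsi, h1.fderiv]
  ext q <;> simp

theorem mem_solMap_iff {p q : E × F} :
    q ∈ solMap f Φ θ p ↔ Psi f Φ q.1 q.2 = p.1 ∧ q.2 ∈ subdiff θ (Φ q.1 + p.2) := by
  obtain ⟨p₁, p₂⟩ := p
  simp only [solMap, mapG, mem_ofPred_eq, singleton_add, mem_image, mem_prod, mem_singleton_iff,
    Prod.exists, Prod.mk_add_mk, Prod.mk.injEq]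
  constructor
  · rintro ⟨_, z, ⟨rfl, hz⟩, h1, rfl⟩
    exact ⟨by simpa using h1, by simpa using hz⟩
  · rintro ⟨h1, h2⟩
    exact ⟨0, Φ q.1 + p₂, ⟨rfl, h2⟩, by simpa using h1, by simp⟩

theorem mem_solMap_zero_iff {q : E × F} :
    q ∈ solMap f Φ θ (0, 0) ↔ q.2 ∈ multipliers f Φ θ q.1 := by
  rw [mem_solMap_iff, add_zero]
  rfl

theorem isNoncritical_iff : IsNoncritical f Φ θ xbar vbar ↔
    ∀ (ξ : E) (η : F), gradPsi f Φ xbar vbar ξ + gradAdj Φ xbar η = 0 →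
      η ∈ graphicalDeriv (subdiff θ) (Φ xbar) vbar (fderiv ℝ Φ xbar ξ) → ξ = 0 := by
  constructor
  · intro h ξ η h0 hη
    by_contra hξ
    exact h ⟨ξ, hξ, add_mem_add (mem_singleton _) (mem_image_of_mem _ hη) |> h0.subst⟩
  · rintro h ⟨ξ, hξ, hmem⟩
    obtain ⟨_, rfl, _, ⟨η, hη, rfl⟩, h0⟩ := mem_add.1 hmem
    exact hξ (h ξ η h0 hη)

/-! ### Isolated calmness -/

theorem IsIsolatedlyCalmAt.exists_inter_eq {X Y : Type*} [NormedAddCommGroup X] [NormedSpace ℝ X]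
    [NormedAddCommGroup Y] [NormedSpace ℝ Y] {S : X → Set Y} {x₀ : X} {y₀ : Y}
    (h : IsIsolatedlyCalmAt S x₀ y₀) : ∃ V ∈ 𝓝 y₀, S x₀ ∩ V = {y₀} := by
  obtain ⟨h0, ℓ, -, U, hU, V, hV, hS⟩ := h
  refine ⟨V, hV, Subset.antisymm ?_ (singleton_subset_iff.2 ⟨h0, mem_of_mem_nhds hV⟩)⟩
  simpa using hS x₀ (mem_of_mem_nhds hU)

theorem exists_seq_of_not_isIsolatedlyCalmAt {X Y : Type*} [NormedAddCommGroup X]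
    [NormedSpace ℝ X] [NormedAddCommGroup Y] [NormedSpace ℝ Y] {S : X → Set Y} {x₀ : X} {y₀ : Y}
    (h0 : y₀ ∈ S x₀) (h : ¬ IsIsolatedlyCalmAt S x₀ y₀) :
    ∃ (x : ℕ → X) (y : ℕ → Y), Tendsto x atTop (𝓝 x₀) ∧ Tendsto y atTop (𝓝 y₀) ∧
      ∀ k, y k ∈ S (x k) ∧ (k : ℝ) * ‖x k - x₀‖ < ‖y k - y₀‖ := by
  have hex : ∀ k : ℕ, ∃ x y, dist x x₀ < 1 / ((k : ℝ) + 1) ∧ dist y y₀ < 1 / ((k : ℝ) + 1) ∧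
      y ∈ S x ∧ (k : ℝ) * ‖x - x₀‖ < ‖y - y₀‖ := by
    intro k
    by_contra! hk
    refine h ⟨h0, k, k.cast_nonneg, Metric.ball x₀ (1 / ((k : ℝ) + 1)),
      Metric.ball_mem_nhds _ (by positivity), Metric.ball y₀ (1 / ((k : ℝ) + 1)),
      Metric.ball_mem_nhds _ (by positivity), fun x hx y hy => ?_⟩
    rw [mem_closedBall_iff_norm]
    exact hk x y hx hy.2 hy.1
  choose x y hx hy hxy using hex
  refine ⟨x, y, ?_, ?_, hxy⟩
  · exact tendsto_iff_dist_tendsto_zero.2 (squeeze_zero (fun _ => dist_nonneg)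
      (fun k => (hx k).le) tendsto_one_div_add_atTop_nhds_zero_nat)
  · exact tendsto_iff_dist_tendsto_zero.2 (squeeze_zero (fun _ => dist_nonneg)
      (fun k => (hy k).le) tendsto_one_div_add_atTop_nhds_zero_nat)

/-- Normalized differences converge along an ultrafilter in finite dimension. -/
theorem exists_tendsto_inv_norm_smul {X α : Type*} [NormedAddCommGroup X] [NormedSpace ℝ X]
    [FiniteDimensional ℝ X] (l : Ultrafilter α) {u : α → X} (hu : ∀ᶠ k in l, u k ≠ 0) :
    ∃ ζ : X, ‖ζ‖ = 1 ∧ Tendsto (fun k => ‖u k‖⁻¹ • u k) l (𝓝 ζ) := by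
  have := FiniteDimensional.proper_real X
  obtain ⟨ζ, hζ, hlim⟩ := (isCompact_sphere (0 : X) 1).ultrafilter_le_nhds
    (l.map fun k => ‖u k‖⁻¹ • u k) (by
      rw [le_principal_iff]
      change ∀ᶠ k in l, ‖u k‖⁻¹ • u k ∈ Metric.sphere (0 : X) 1
      filter_upwards [hu] with k hk
      simp [norm_smul, hk])
  exact ⟨ζ, by simpa using hζ, hlim⟩

theorem isIsolatedlyCalmAt_of_forall_eq_zero [FiniteDimensional ℝ E] [FiniteDimensional ℝ F]
    (hf : DifferentiableAt ℝ f xbar) (hΦ : DifferentiableAt ℝ Φ xbar)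
    (hΦ₂ : DifferentiableAt ℝ (fderiv ℝ Φ) xbar) (hv : vbar ∈ multipliers f Φ θ xbar)
    (h : ∀ (ξ : E) (η : F), gradPsi f Φ xbar vbar ξ + gradAdj Φ xbar η = 0 →
      η ∈ graphicalDeriv (subdiff θ) (Φ xbar) vbar (fderiv ℝ Φ xbar ξ) → (ξ, η) = (0, 0)) :
    IsIsolatedlyCalmAt (solMap f Φ θ) (0, 0) (xbar, vbar) := by
  by_contra hcalm
  obtain ⟨p, q, hp, hq, hpq⟩ :=
    exists_seq_of_not_isIsolatedlyCalmAt (mem_solMap_zero_iff.2 hv) hcalm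
  have hp' : Tendsto p atTop (𝓝 0) := hp
  obtain ⟨l, hl⟩ : ∃ l : Ultrafilter ℕ, (l : Filter ℕ) ≤ atTop :=
    ⟨Ultrafilter.of atTop, Ultrafilter.of_le _⟩
  have hpos : ∀ k, 0 < ‖q k - (xbar, vbar)‖ := fun k =>
    (mul_nonneg k.cast_nonneg (norm_nonneg _)).trans_lt (hpq k).2
  obtain ⟨ζ, hζ, hζlim⟩ := exists_tendsto_inv_norm_smul l
    (u := fun k => q k - (xbar, vbar)) (.of_forall fun k => norm_pos_iff.1 (hpos k))
  set c : ℕ → ℝ := fun k => ‖q k - (xbar, vbar)‖⁻¹ with hc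
  have hd0 : Tendsto (fun k => q k - (xbar, vbar)) l (𝓝 0) := by
    simpa using (hq.mono_left hl).sub_const (xbar, vbar)
  -- Failure of calmness with constant `k` bounds the scaled perturbation by `1 / k`.
  have hcp : Tendsto (fun k => c k • p k) l (𝓝 0) := by
    refine squeeze_zero_norm' ?_ ((tendsto_inv_atTop_nhds_zero_nat (𝕜 := ℝ)).mono_left hl)
    filter_upwards [hl (eventually_gt_atTop 0)] with k hk
    have hk' : (0 : ℝ) < k := Nat.cast_pos.2 hk
    have hlt : (k : ℝ) * ‖p k‖ < ‖q k - (xbar, vbar)‖ := by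
      simpa [Prod.mk_zero_zero] using (hpq k).2
    rw [norm_smul, norm_inv, norm_norm, inv_mul_eq_div, div_le_iff₀ (hpos k), inv_mul_eq_div,
      le_div_iff₀ hk']
    linarith
  have hPsi := (hasFDerivAt_Psi (vbar := vbar) hf hΦ₂).hasFDerivWithinAt (s := univ)
  have hPhi := hΦ.hasFDerivAt.hasFDerivWithinAt (s := univ)
  have hζ1 : Tendsto (fun k => c k • ((q k).1 - xbar)) l (𝓝 ζ.1) :=
    (continuous_fst.tendsto ζ).comp hζlim
  have hζ2 : Tendsto (fun k => c k • ((q k).2 - vbar)) l (𝓝 ζ.2) :=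
    (continuous_snd.tendsto ζ).comp hζlim
  have hd1 : Tendsto (fun k => (q k).1 - xbar) l (𝓝 0) := (continuous_fst.tendsto 0).comp hd0
  have hcp1 : Tendsto (fun k => c k • (p k).1) l (𝓝 0) := (continuous_fst.tendsto 0).comp hcp
  have hcp2 : Tendsto (fun k => c k • (p k).2) l (𝓝 0) := (continuous_snd.tendsto 0).comp hcp
  have hp2 : Tendsto (fun k => (p k).2) l (𝓝 0) :=
    (continuous_snd.tendsto 0).comp (hp'.mono_left hl)
  have hzero : gradPsi f Φ xbar vbar ζ.1 + gradAdj Φ xbar ζ.2 = 0 := by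
    refine tendsto_nhds_unique (hPsi.lim hd0 (.of_forall fun _ => mem_univ _) hζlim) ?_
    refine hcp1.congr fun k => ?_
    have h1 : Psi f Φ (q k).1 (q k).2 = (p k).1 := (mem_solMap_iff.1 (hpq k).1).1
    have h2 : Psi f Φ xbar vbar = 0 := hv.1
    simp only [add_sub_cancel, h1, h2, sub_zero, hc]
  have hPhilim := hPhi.lim hd1 (.of_forall fun _ => mem_univ _) hζ1
  simp only [add_sub_cancel] at hPhilim
  have hΦq : Tendsto (fun k => Φ (q k).1) l (𝓝 (Φ xbar)) :=
    hΦ.continuousAt.tendsto.comp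
      ((continuous_fst.tendsto (xbar, vbar)).comp (hq.mono_left hl))
  have htan : ζ.2 ∈ graphicalDeriv (subdiff θ) (Φ xbar) vbar (fderiv ℝ Φ xbar ζ.1) := by
    refine mem_tangentConeAt_of_seq (l : Filter ℕ)
      (fun k => (⟨c k, inv_nonneg.2 (norm_nonneg _)⟩ : NNReal))
      (fun k => (Φ (q k).1 + (p k).2 - Φ xbar, (q k).2 - vbar)) ?_ ?_ ?_
    · have h1 : Tendsto (fun k => Φ (q k).1 + (p k).2 - Φ xbar) l (𝓝 0) := by
        simpa using (hΦq.add hp2).sub_const (Φ xbar)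
      exact h1.prodMk_nhds ((continuous_snd.tendsto 0).comp hd0)
    · refine .of_forall fun k => ?_
      simpa [gph] using (mem_solMap_iff.1 (hpq k).1).2
    · refine Tendsto.prodMk_nhds ?_ hζ2
      have := hPhilim.add hcp2
      rw [add_zero] at this
      refine this.congr fun k => ?_
      change c k • (Φ (q k).1 - Φ xbar) + c k • (p k).2 = c k • (Φ (q k).1 + (p k).2 - Φ xbar)
      module
  have := h ζ.1 ζ.2 hzero htan
  rw [show ζ = 0 from this] at hζ
  simp at hζ

/-- Tangent directions are limits of `c k • d k` with `c k → ∞` and `x + d k ∈ s`. -/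
theorem exists_seq_of_mem_posTangentConeAt {X : Type*} [NormedAddCommGroup X] [NormedSpace ℝ X]
    {s : Set X} {x w : X} (hx : x ∈ s) (hw : w ∈ posTangentConeAt s x) :
    ∃ (c : ℕ → ℝ) (d : ℕ → X), Tendsto c atTop atTop ∧ (∀ k, x + d k ∈ s) ∧
      Tendsto (fun k => c k • d k) atTop (𝓝 w) := by
  have hex : ∀ k : ℕ, ∃ (c : ℝ) (d : X), (k : ℝ) < c ∧ x + d ∈ s ∧
      dist (c • d) w < 1 / ((k : ℝ) + 1) := by
    intro k
    -- The zero direction does not force the scale to be large, so `d = 0` is used, which needs `x ∈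
    -- s`. Otherwise `d n → 0` and `c n • d n → w ≠ 0` push `c n` beyond `k`.
    by_cases hw0 : w = 0
    · exact ⟨k + 1, 0, by simp, by simpa using hx, by simp [hw0]; positivity⟩
    obtain ⟨α, l, _, c, d, hd0, hds, hcd⟩ := exists_fun_of_mem_tangentConeAt hw
    have h1 : Tendsto (fun n => (k : ℝ) * ‖d n‖) l (𝓝 0) := by
      simpa using hd0.norm.const_mul (k : ℝ)
    have h2 := h1.eventually_lt hcd.norm (norm_pos_iff.2 hw0)
    obtain ⟨n, hn1, hn2, hn3⟩ := (h2.and (hds.and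
      (hcd.eventually (Metric.ball_mem_nhds w (by positivity : 0 < 1 / ((k : ℝ) + 1)))))).exists
    refine ⟨c n, d n, ?_, hn2, hn3⟩
    rw [NNReal.smul_def, norm_smul, Real.norm_of_nonneg (c n).coe_nonneg] at hn1
    exact lt_of_mul_lt_mul_right hn1 (norm_nonneg _)
  choose c d hc hd hcd using hex
  refine ⟨c, d, tendsto_atTop_mono (fun k => (hc k).le) tendsto_natCast_atTop_atTop, hd, ?_⟩
  exact tendsto_iff_dist_tendsto_zero.2 (squeeze_zero (fun _ => dist_nonneg)
    (fun k => (hcd k).le) tendsto_one_div_add_atTop_nhds_zero_nat)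

theorem eq_zero_of_isIsolatedlyCalmAt
    (hf : DifferentiableAt ℝ f xbar) (hΦ : DifferentiableAt ℝ Φ xbar)
    (hΦ₂ : DifferentiableAt ℝ (fderiv ℝ Φ) xbar) (hv : vbar ∈ multipliers f Φ θ xbar)
    (h : IsIsolatedlyCalmAt (solMap f Φ θ) (0, 0) (xbar, vbar)) {ξ : E} {η : F}
    (h0 : gradPsi f Φ xbar vbar ξ + gradAdj Φ xbar η = 0)
    (hη : η ∈ graphicalDeriv (subdiff θ) (Φ xbar) vbar (fderiv ℝ Φ xbar ξ)) :
    (ξ, η) = (0, 0) := by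
  obtain ⟨-, ℓ, -, U, hU, V, hV, hS⟩ := h
  obtain ⟨c, d, hc, hds, hcd⟩ := exists_seq_of_mem_posTangentConeAt
    (s := gph (subdiff θ)) (x := (Φ xbar, vbar)) hv.2 hη
  have hcinv : Tendsto (fun k => (c k)⁻¹) atTop (𝓝 0) := tendsto_inv_atTop_zero.comp hc
  have hcpos : ∀ᶠ k in atTop, 0 < c k := hc.eventually_gt_atTop 0
  have hcd1 : Tendsto (fun k => c k • (d k).1) atTop (𝓝 (fderiv ℝ Φ xbar ξ)) :=
    (continuous_fst.tendsto (fderiv ℝ Φ xbar ξ, η)).comp hcd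
  have hcd2 : Tendsto (fun k => c k • (d k).2) atTop (𝓝 η) :=
    (continuous_snd.tendsto (fderiv ℝ Φ xbar ξ, η)).comp hcd
  set e : ℕ → E × F := fun k => ((c k)⁻¹ • ξ, (d k).2) with he
  have hce : Tendsto (fun k => c k • e k) atTop (𝓝 (ξ, η)) := by
    refine Tendsto.prodMk_nhds (tendsto_const_nhds.congr' ?_) hcd2
    filter_upwards [hcpos] with k hk
    exact (smul_inv_smul₀ hk.ne' ξ).symm
  have hto_zero : ∀ {Z : Type _} [NormedAddCommGroup Z] [NormedSpace ℝ Z] {u : ℕ → Z} {ζ : Z},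
      Tendsto (fun k => c k • u k) atTop (𝓝 ζ) → Tendsto u atTop (𝓝 0) := by
    intro Z _ _ u ζ hu
    have := hcinv.smul hu
    rw [zero_smul] at this
    refine this.congr' ?_
    filter_upwards [hcpos] with k hk
    exact inv_smul_smul₀ hk.ne' (u k)
  have he0 : Tendsto e atTop (𝓝 0) := hto_zero hce
  have he1 : Tendsto (fun k => (e k).1) atTop (𝓝 0) := (continuous_fst.tendsto 0).comp he0
  have hce1 : Tendsto (fun k => c k • (e k).1) atTop (𝓝 ξ) :=
    (continuous_fst.tendsto (ξ, η)).comp hce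
  -- These are exactly the perturbations that make the displaced point a solution; both components
  -- are `o(1 / c k)`, by `h0` and because `d k` is tangent in the direction `∇Φ(xbar) ξ`.
  set p : ℕ → E × F := fun k =>
    (Psi f Φ (xbar + (e k).1) (vbar + (e k).2), Φ xbar + (d k).1 - Φ (xbar + (e k).1)) with hp
  have hcp : Tendsto (fun k => c k • p k) atTop (𝓝 (0, 0)) := by
    refine Tendsto.prodMk_nhds ?_ ?_
    · have := ((hasFDerivAt_Psi (vbar := vbar) hf hΦ₂).hasFDerivWithinAt (s := univ)).lim he0
        (.of_forall fun _ => mem_univ _) hce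
      rw [ContinuousLinearMap.coprod_apply, h0] at this
      refine this.congr fun k => ?_
      have h2 : Psi f Φ xbar vbar = 0 := hv.1
      simp [h2, hp]
    · have := hcd1.sub ((hΦ.hasFDerivAt.hasFDerivWithinAt (s := univ)).lim he1
        (.of_forall fun _ => mem_univ _) hce1)
      rw [sub_self] at this
      refine this.congr fun k => ?_
      simp only [hp]
      module
  have hp0 : Tendsto p atTop (𝓝 (0, 0)) := hto_zero hcp
  have hq : Tendsto (fun k => (xbar, vbar) + e k) atTop (𝓝 (xbar, vbar)) := by
    simpa using he0.const_add (xbar, vbar)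
  have hmem : ∀ k, (xbar, vbar) + e k ∈ solMap f Φ θ (p k) := fun k => by
    rw [mem_solMap_iff]
    refine ⟨rfl, ?_⟩
    have : vbar + (d k).2 ∈ subdiff θ (Φ xbar + (d k).1) := hds k
    simpa [hp, he] using this
  have hle : ∀ᶠ k in atTop, ‖c k • e k‖ ≤ ℓ * ‖c k • p k‖ := by
    filter_upwards [hp0.eventually hU, hq.eventually hV] with k hkU hkV
    have := hS (p k) hkU ⟨hmem k, hkV⟩
    rw [mem_closedBall_iff_norm, add_sub_cancel_left, Prod.mk_zero_zero, sub_zero] at this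
    rw [norm_smul, norm_smul]
    nlinarith [mul_le_mul_of_nonneg_left this (norm_nonneg (c k))]
  have := le_of_tendsto_of_tendsto hce.norm (hcp.norm.const_mul ℓ) hle
  rw [Prod.mk_zero_zero, norm_zero, mul_zero] at this
  exact norm_le_zero_iff.1 this

/-! ### Convex piecewise linear functions -/

theorem eventually_fst_eq_of_isNoncritical [FiniteDimensional ℝ E] [FiniteDimensional ℝ F]
    (hf : DifferentiableAt ℝ f xbar) (hΦ : DifferentiableAt ℝ Φ xbar)
    (hΦ₂ : DifferentiableAt ℝ (fderiv ℝ Φ) xbar) (hv : vbar ∈ multipliers f Φ θ xbar)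
    (hθ : IsCPWL θ) (h : IsNoncritical f Φ θ xbar vbar) :
    ∀ᶠ q in 𝓝 (xbar, vbar), q ∈ solMap f Φ θ (0, 0) → q.1 = xbar := by
  by_contra hcon
  rw [not_eventually, frequently_iff_neBot] at hcon
  -- The ultrafilter lives on the space of pairs itself, so the bad points are indexed by
  -- themselves.
  set l := Ultrafilter.of (𝓝 (xbar, vbar) ⊓
    𝓟 {q | ¬ (q ∈ solMap f Φ θ (0, 0) → q.1 = xbar)}) with hldef
  have hle := Ultrafilter.of_le (𝓝 (xbar, vbar) ⊓
    𝓟 {q | ¬ (q ∈ solMap f Φ θ (0, 0) → q.1 = xbar)})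
  rw [← hldef] at hle
  have hq : Tendsto id (l : Filter (E × F)) (𝓝 (xbar, vbar)) := hle.trans inf_le_left
  have hbad : ∀ᶠ q in (l : Filter (E × F)), q ∈ solMap f Φ θ (0, 0) ∧ q.1 ≠ xbar := by
    have : ∀ᶠ q in (l : Filter (E × F)), ¬ (q ∈ solMap f Φ θ (0, 0) → q.1 = xbar) :=
      le_principal_iff.1 (hle.trans inf_le_right)
    filter_upwards [this] with q hq using Classical.not_imp.1 hq
  have hx : Tendsto Prod.fst (l : Filter (E × F)) (𝓝 xbar) :=
    (continuous_fst.tendsto (xbar, vbar)).comp hq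
  have hvl : Tendsto Prod.snd (l : Filter (E × F)) (𝓝 vbar) :=
    (continuous_snd.tendsto (xbar, vbar)).comp hq
  obtain ⟨ξ, hξ, hξlim⟩ := exists_tendsto_inv_norm_smul l (u := fun q : E × F => q.1 - xbar)
    (hbad.mono fun q hq => sub_ne_zero.2 hq.2)
  set c : E × F → ℝ := fun q => ‖q.1 - xbar‖⁻¹ with hc
  have hd : Tendsto (fun q : E × F => q.1 - xbar) l (𝓝 0) := by
    simpa using hx.sub_const xbar
  have hdv : Tendsto (fun q : E × F => q.2 - vbar) l (𝓝 0) := by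
    simpa using hvl.sub_const vbar
  have hPhilim := (hΦ.hasFDerivAt.hasFDerivWithinAt (s := univ)).lim hd
    (.of_forall fun _ => mem_univ _) hξlim
  simp only [add_sub_cancel] at hPhilim
  have hgrad : HasFDerivAt (fun x => Psi f Φ x vbar) (gradPsi f Φ xbar vbar) xbar := by
    have := HasFDerivAt.comp xbar (f := fun x : E => (x, vbar)) (hasFDerivAt_Psi hf hΦ₂)
      (hasFDerivAt_prodMk_left xbar vbar)
    exact this.differentiableAt.hasFDerivAt
  have hPsilim := (hgrad.hasFDerivWithinAt (s := univ)).lim hd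
    (.of_forall fun _ => mem_univ _) hξlim
  simp only [add_sub_cancel] at hPsilim
  have hAdjlim := ((differentiableAt_gradAdj hΦ₂).hasFDerivAt.hasFDerivWithinAt (s := univ)).lim hd
    (.of_forall fun _ => mem_univ _) hξlim
  simp only [add_sub_cancel] at hAdjlim
  -- Subtracting the two equations `Ψ = 0` leaves the increment of `Ψ(·, vbar)` and the term
  -- `(∇Φ(x)* - ∇Φ(xbar)*)(v - vbar)`, which vanishes after scaling because `v → vbar`.
  have hTlim : Tendsto (fun q : E × F => c q • gradAdj Φ xbar (q.2 - vbar)) l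
      (𝓝 (-gradPsi f Φ xbar vbar ξ)) := by
    have hrem := (isBoundedBilinearMap_apply.continuous.tendsto _).comp
      (hAdjlim.prodMk_nhds hdv)
    simp only [Function.comp_def, map_zero] at hrem
    have := (hPsilim.add hrem).neg
    rw [add_zero] at this
    refine this.congr' ?_
    filter_upwards [hbad] with q hq
    have h1 : f q.1 + gradAdj Φ q.1 q.2 = 0 := (mem_solMap_iff.1 hq.1).1
    have h2 : f xbar + gradAdj Φ xbar vbar = 0 := hv.1
    have h3 : f q.1 = -gradAdj Φ q.1 q.2 := eq_neg_of_add_eq_zero_left h1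
    have h4 : f xbar = -gradAdj Φ xbar vbar := eq_neg_of_add_eq_zero_left h2
    simp only [Psi, h3, h4, map_sub, smul_apply, sub_apply]
    module
  obtain ⟨η, hη, hmem⟩ := exists_mem_graphicalDeriv_of_tendsto hθ hv.2 l
    (z := fun q => Φ q.1) (v := Prod.snd) (c := c) (gradAdj Φ xbar).toLinearMap
    (hbad.mono fun q hq => (mem_solMap_zero_iff.1 hq.1).2)
    (.of_forall fun q => inv_nonneg.2 (norm_nonneg _))
    (hΦ.continuousAt.tendsto.comp hx) hvl hPhilim hTlim
  have hη' : gradAdj Φ xbar η = -gradPsi f Φ xbar vbar ξ := hη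
  have := isNoncritical_iff.1 h ξ η (by rw [hη', add_neg_cancel]) hmem
  rw [this] at hξ
  simp at hξ

end System

end VarSys

theorem theorem7p1 (n m : ℕ)
    (f : EuclideanSpace ℝ (Fin n) → EuclideanSpace ℝ (Fin n))
    (Φ : EuclideanSpace ℝ (Fin n) → EuclideanSpace ℝ (Fin m))
    (θ : EuclideanSpace ℝ (Fin m) → EReal)
    (xbar : EuclideanSpace ℝ (Fin n)) (vbar : EuclideanSpace ℝ (Fin m))
    (hθ : IsProper θ)
    (hf : DifferentiableAt ℝ f xbar)
    (hΦ : Differentiable ℝ Φ)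
    (hΦ₂ : DifferentiableAt ℝ (fderiv ℝ Φ) xbar)
    (hv : vbar ∈ multipliers f Φ θ xbar) :
    -- noncriticality
    (IsNoncritical f Φ θ xbar vbar ↔
      ∀ (ξ : EuclideanSpace ℝ (Fin n)) (η : EuclideanSpace ℝ (Fin m)),
        gradPsi f Φ xbar vbar ξ + gradAdj Φ xbar η = 0 →
        η ∈ graphicalDeriv (subdiff θ) (Φ xbar) vbar (fderiv ℝ Φ xbar ξ) →
        ξ = 0) ∧
    -- isolated calmness
    (IsIsolatedlyCalmAt (solMap f Φ θ) (0, 0) (xbar, vbar) ↔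
      ∀ (ξ : EuclideanSpace ℝ (Fin n)) (η : EuclideanSpace ℝ (Fin m)),
        gradPsi f Φ xbar vbar ξ + gradAdj Φ xbar η = 0 →
        η ∈ graphicalDeriv (subdiff θ) (Φ xbar) vbar (fderiv ℝ Φ xbar ξ) →
        (ξ, η) = (0, 0)) ∧
    (IsIsolatedlyCalmAt (solMap f Φ θ) (0, 0) (xbar, vbar) →
      ∃ V ∈ 𝓝 (xbar, vbar), solMap f Φ θ (0, 0) ∩ V = {(xbar, vbar)}) ∧
    -- the convex piecewise linear case
    (IsCPWL θ → IsNoncritical f Φ θ xbar vbar →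
      ∃ V ∈ 𝓝 (xbar, vbar),
        solMap f Φ θ (0, 0) ∩ V = ({xbar} ×ˢ multipliers f Φ θ xbar) ∩ V) := by
  refine ⟨isNoncritical_iff, ⟨fun h ξ η h0 hη => ?_, fun h => ?_⟩, fun h => h.exists_inter_eq,
    fun hcpwl h => ?_⟩
  · exact eq_zero_of_isIsolatedlyCalmAt hf (hΦ xbar) hΦ₂ hv h h0 hη
  · exact isIsolatedlyCalmAt_of_forall_eq_zero hf (hΦ xbar) hΦ₂ hv h
  -- `V` is the set of pairs satisfying the implication itself, which is a neighborhood by the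
  -- lemma.
  · refine ⟨_, eventually_fst_eq_of_isNoncritical hf (hΦ xbar) hΦ₂ hv hcpwl h, ?_⟩
    ext ⟨x, v⟩
    constructor
    · rintro ⟨hS, hV⟩
      have hx : x = xbar := hV hS
      subst hx
      exact ⟨⟨rfl, mem_solMap_zero_iff.1 hS⟩, hV⟩
    · rintro ⟨⟨hx, hm⟩, hV⟩
      have hx : x = xbar := hx
      subst hx
      exact ⟨mem_solMap_zero_iff.2 hm, hV⟩
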